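/- Let $n\ge 1$ and $\mathcal R=\mathbb F_2[x]/\langle x^n-1\rangle$, whose elements are written as polynomials of degree less than $n$ and identified with their coefficient vectors in $\mathbb F_2^n$. For $g=\sum_{i<n} g_ix^i$ put $\bar g(x)=g_0+g_{n-1}x+g_{n-2}x^2+\cdots+g_1x^{n-1}$, and for $g\mid x^n-1$ with $gh=x^n-1$ put $g^{\perp}(x)=x^{\deg h}h(1/x)$. For $u,w\in\mathbb F_2^{2n}$ let $\langle u,w\rangle_s=\sum_{i=0}^{n-1}(u_iw_{n+i}-u_{n+i}w_i)$, let $w_s(u)$ be the number of $0\le i<n$ with $(u_i,u_{n+i})\ne(0,0)$, and for a linear code $\mathscr C\subseteq\mathbb F_2^{2n}$ let $\mathscr C^{\perp_s}$ be its dual with respect to $\langle\cdot,\cdot\rangle_s$. Quantum codes are subspaces $Q$ of $(\mathbb C^2)^{\otimes n}$, with orthogonal projection $P$; errors are the Pauli operators $E$ on $n$ qubits (up to phase), and the weight of $E$ is the number of qubits on which it acts nontrivially. $Q$ detects $E$ if $PEP=cP$ for some scalar $c$, and its minimum distance is the smallest weight of an error that it does not detect; if $\dim Q=1$, its minimum distance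 is by convention the smallest weight of a nonidentity $E$ with $PEP\ne0$. A pure $[[n,k,d]]$ code is a $Q$ with $\dim Q=2^k$ such that $PEP=0$ for every $E$ with $1\le \mathrm{wt}(E)<d$, where $d$ is the largest number with this property (so every error of weight less than $d$ is detected). **Theorem.** Let $g_1,g_2\in\mathbb F_2[x]$ be divisors of $x^n-1$ and let $v\in\mathbb F_2[x]$ have degree less than $n$, with $\gcd(g_1,g_2)=1$ and $\gcd(v-1,x^n-1)=1$. Let $\mathscr C\subseteq\mathbb F_2^{2n}$ be the quasi-cyclic code that corresponds to the $\mathcal R$-submodule of $\mathcal R^2$ generated by $(vg_1,g_1)$ and $(g_2,vg_2)$. Suppose that $g_2\mid g_1^{\perp}$ and $\bar v=v$. Then $k:=n-\deg g_1-\deg g_2\ge0$, the minimum $d=\min\{w_s(u): u\in\mathscr C,\ u\neq0\}$ exists, and there is a pure $[[n,k,d]]$ binary quantum code $Q$. Its minimum distance is at least $d$, and it is exactly $d$ if and only if $k=0$ or some $u\in\mathscr C\setminus\mathscr C^{\perp_s}$ has $w_s(u)=d$. -/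

import Mathlib

open Polynomial

noncomputable section

/-- Vectors `u = (u₀, …, u_{n-1} | u_n, …, u_{2n-1})` of `F₂^{2n}`, split into their two halves. -/
abbrev SympVec (n : ℕ) : Type := (Fin n → ZMod 2) × (Fin n → ZMod 2)

/-- The symplectic inner product `∑ i, (u_i w_{n+i} - u_{n+i} w_i)`. -/
def sympForm {n : ℕ} (u w : SympVec n) : ZMod 2 :=
  ∑ i, (u.1 i * w.2 i - u.2 i * w.1 i)

/-- The symplectic weight: the number of `i` with `(u_i, u_{n+i}) ≠ (0, 0)`. -/
def sympWt {n : ℕ} (u : SympVec n) : ℕ :=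
  (Finset.univ.filter fun i => (u.1 i, u.2 i) ≠ (0, 0)).card

/-- The symplectic dual code. -/
def sympDual {n : ℕ} (C : Submodule (ZMod 2) (SympVec n)) : Set (SympVec n) :=
  {w | ∀ u ∈ C, sympForm u w = 0}

/-- `d` is the minimum symplectic weight of the nonzero words of `C`. -/
def IsMinSympWt {n : ℕ} (C : Submodule (ZMod 2) (SympVec n)) (d : ℕ) : Prop :=
  IsLeast {t | ∃ u ∈ C, u ≠ 0 ∧ sympWt u = t} d

/-- The ring `F₂[x] / ⟨xⁿ - 1⟩`. -/
abbrev CycRing (n : ℕ) : Type := AdjoinRoot (X ^ n - 1 : (ZMod 2)[X])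

/-- The identification of a vector `(a₀, …, a_{n-1})` with `a₀ + a₁ x + ⋯ + a_{n-1} x^{n-1}`
in `F₂[x] / ⟨xⁿ - 1⟩`. -/
def vecToRing (n : ℕ) : (Fin n → ZMod 2) →ₗ[ZMod 2] CycRing n :=
  Fintype.linearCombination (ZMod 2) fun i : Fin n =>
    AdjoinRoot.root (X ^ n - 1 : (ZMod 2)[X]) ^ (i : ℕ)

/-- The binary quasi-cyclic code of length `2n` and index `2` generated, as a module over
`F₂[x] / ⟨xⁿ - 1⟩`, by the pairs `(v g₁, g₁)` and `(g₂, v g₂)`. -/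
def twoGenQCCode (n : ℕ) (g₁ g₂ v : (ZMod 2)[X]) : Submodule (ZMod 2) (SympVec n) :=
  ((Submodule.span (CycRing n)
      {((AdjoinRoot.mk _ (v * g₁), AdjoinRoot.mk _ g₁) : CycRing n × CycRing n),
       ((AdjoinRoot.mk _ g₂, AdjoinRoot.mk _ (v * g₂)) : CycRing n × CycRing n)}).restrictScalars
    (ZMod 2)).comap ((vecToRing n).prodMap (vecToRing n))

/-- For `g = g₀ + g₁ x + ⋯ + g_{n-1} x^{n-1}`, the polynomial
`g₀ + g_{n-1} x + g_{n-2} x² + ⋯ + g₁ x^{n-1}`. -/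
def barPoly (n : ℕ) (g : (ZMod 2)[X]) : (ZMod 2)[X] :=
  ∑ j ∈ Finset.range n, C (g.coeff ((n - j) % n)) * X ^ j

/-- For a divisor `g` of `xⁿ - 1` with `g h = xⁿ - 1`, the polynomial
`x ^ deg h * h (1 / x)`. -/
def perpPoly (n : ℕ) (g : (ZMod 2)[X]) : (ZMod 2)[X] :=
  ((X ^ n - 1) / g).reverse

/-- The state space `(ℂ²)^{⊗ n}` of `n` qubits, with its orthonormal basis `|x⟩`,
`x ∈ F₂ⁿ`. -/
abbrev QubitSpace (n : ℕ) : Type := EuclideanSpace ℂ (Fin n → ZMod 2)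

/-- The Pauli error attached to `u = (a | b)`: the operator
`X^{a₀} Z^{b₀} ⊗ ⋯ ⊗ X^{a_{n-1}} Z^{b_{n-1}}`, that is, `|y⟩ ↦ (-1)^{b · y} |y + a⟩`.
Every element of the Pauli group is such an operator times a phase, and the number of qubits on
which it acts nontrivially is `sympWt u`. -/
def pauli {n : ℕ} (u : SympVec n) : QubitSpace n →ₗ[ℂ] QubitSpace n :=
  Matrix.toEuclideanLin (Matrix.of fun x y : Fin n → ZMod 2 =>
    if x = y + u.1 then (-1 : ℂ) ^ (∑ i, u.2 i * y i).val else 0)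

/-- The code `Q` detects the error `E` of `u`: `P E P = c P` for a scalar `c`, where `P` is the
orthogonal projection onto `Q`. -/
def Detects {n : ℕ} (Q : Submodule ℂ (QubitSpace n)) (u : SympVec n) : Prop :=
  ∃ c : ℂ, ∀ φ ∈ Q, ∀ ψ ∈ Q, inner ℂ φ (pauli u ψ) = c * inner ℂ φ ψ

/-- The error `E` of `u` maps `Q` into its orthogonal complement: `P E P = 0`. -/
def DetectsPurely {n : ℕ} (Q : Submodule ℂ (QubitSpace n)) (u : SympVec n) : Prop :=
  ∀ φ ∈ Q, ∀ ψ ∈ Q, inner ℂ φ (pauli u ψ) = 0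

/-- `d` is the smallest weight of a nonidentity Pauli error that does not map `Q` into its
orthogonal complement. Equivalently, `d` is the largest number such that `Q` is pure to `d`. -/
def HasPureDistance {n : ℕ} (Q : Submodule ℂ (QubitSpace n)) (d : ℕ) : Prop :=
  IsLeast {t | ∃ u : SympVec n, u ≠ 0 ∧ ¬ DetectsPurely Q u ∧ sympWt u = t} d

open Classical in
/-- `d` is the minimum distance of `Q`: the smallest weight of an undetectable Pauli error. For a
one-dimensional code, which detects every error in a trivial way, the usual convention takes the
pure distance instead. -/
def HasMinDistance {n : ℕ} (Q : Submodule ℂ (QubitSpace n)) (d : ℕ) : Prop :=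
  if Module.finrank ℂ Q = 1 then HasPureDistance Q d
  else IsLeast {t | ∃ u : SympVec n, ¬ Detects Q u ∧ sympWt u = t} d

/-- `Q` is a pure `[[n, k, d]]` code: it has dimension `2 ^ k`, every nonidentity Pauli error of
weight less than `d` maps `Q` into its orthogonal complement (so that all these errors are
detected), and `d` is the largest number with this property. -/
structure IsPureQuantumCode (n k d : ℕ) (Q : Submodule ℂ (QubitSpace n)) : Prop where
  finrank_eq : Module.finrank ℂ Q = 2 ^ k
  pure_distance : HasPureDistance Q d

end

/-! The quantum code is the stabilizer code of $S=\mathscr C^{\perp_s}$, so the work is to show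
$S\subseteq\mathscr C$ and to compute $\dim\mathscr C$.

Quantum side (`exists_stabilizer_code`): the Pauli operators of a self-orthogonal $S$ commute, and
each independent one halves the joint eigenspace, leaving $Q$ of dimension $2^{n-\dim S}$. An error
outside $S^{\perp_s}=\mathscr C$ anticommutes with a stabilizer, so $PEP=0$. An error in $\mathscr
C$ preserves $Q$; it is a scalar there exactly when it lies in $S$. Hence the pure distance is the
minimum weight of $\mathscr C\setminus\{0\}$, and for $k>0$ the minimum distance is that of
$\mathscr C\setminus S$.

Classical side: $\mathscr C$ is the image of $(g_1)\times(g_2)$ under $(a,b)\mapsto(va+b,a+vb)$. Its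
determinant $v^2-1=(v-1)^2$ is a unit, so $\dim\mathscr C=2n-\deg g_1-\deg g_2$
(`finrank_twoGenQCCode`). The symplectic form is the constant coefficient of $u_1\bar w_2-u_2\bar
w_1$, so orthogonality to the module $\mathscr C$ becomes two equations in $\mathcal R$. With $\bar
v=v$ and $g_2\mid g_1^\perp$ they say that the coordinates of $w$ lie in $(g_1)$ and $(g_2)$
(`orthogonal_twoGenQCCode_le`). -/

/-! ### The symplectic form -/

/-- The symplectic inner product as a bilinear form. -/
def sympBilin (n : ℕ) : LinearMap.BilinForm (ZMod 2) (SympVec n) :=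
  LinearMap.mk₂ (ZMod 2) sympForm
    (fun u u' w => by
      simp only [sympForm, ← Finset.sum_add_distrib, Prod.fst_add, Prod.snd_add, Pi.add_apply]
      exact Finset.sum_congr rfl fun i _ => by ring)
    (fun c u w => by
      simp only [sympForm, smul_eq_mul, Finset.mul_sum, Prod.smul_fst, Prod.smul_snd, Pi.smul_apply]
      exact Finset.sum_congr rfl fun i _ => by ring)
    (fun u w w' => by
      simp only [sympForm, ← Finset.sum_add_distrib, Prod.fst_add, Prod.snd_add, Pi.add_apply]
      exact Finset.sum_congr rfl fun i _ => by ring)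
    (fun c u w => by
      simp only [sympForm, smul_eq_mul, Finset.mul_sum, Prod.smul_fst, Prod.smul_snd, Pi.smul_apply]
      exact Finset.sum_congr rfl fun i _ => by ring)

theorem sympForm_self {n : ℕ} (u : SympVec n) : sympForm u u = 0 :=
  Finset.sum_eq_zero fun i _ => by ring

theorem sympBilin_isAlt (n : ℕ) : (sympBilin n).IsAlt := sympForm_self

theorem sympForm_single_right {n : ℕ} (u : SympVec n) (i : Fin n) :
    sympForm u (0, Pi.single i 1) = u.1 i := by
  simp [sympForm, Pi.single_apply]

theorem sympForm_single_left {n : ℕ} (u : SympVec n) (i : Fin n) :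
    sympForm u (Pi.single i 1, 0) = u.2 i := by
  simp [sympForm, Pi.single_apply]

theorem sympBilin_nondegenerate (n : ℕ) : (sympBilin n).Nondegenerate := by
  refine (sympBilin_isAlt n).isRefl.nondegenerate_iff_separatingLeft.2 fun u hu => ?_
  ext i
  · exact (sympForm_single_right u i).symm.trans (hu _)
  · exact (sympForm_single_left u i).symm.trans (hu _)

theorem coe_orthogonal_sympBilin {n : ℕ} (C : Submodule (ZMod 2) (SympVec n)) :
    ((sympBilin n).orthogonal C : Set (SympVec n)) = sympDual C := rfl

/-- By nondegeneracy `S` is its own double orthogonal. This supplies the anticommuting Pauli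
operators used below. -/
theorem exists_sympForm_eq_one {n : ℕ} {S : Submodule (ZMod 2) (SympVec n)} {u : SympVec n}
    (hu : u ∉ S) : ∃ w ∈ (sympBilin n).orthogonal S, sympForm u w = 1 := by
  rw [← LinearMap.BilinForm.orthogonal_orthogonal (sympBilin_nondegenerate n)
    (sympBilin_isAlt n).isRefl S, LinearMap.BilinForm.mem_orthogonal_iff] at hu
  push Not at hu
  obtain ⟨w, hw, hwu⟩ := hu
  refine ⟨w, hw, Fin.eq_one_of_ne_zero _ fun h => hwu ?_⟩
  exact (sympBilin_isAlt n).isRefl _ _ h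

/-! ### Pauli operators and their commutation -/

/-- The sign `(-1) ^ t` of a class `t` modulo `2`. -/
noncomputable def signChar (t : ZMod 2) : ℂ := (-1) ^ t.val

theorem signChar_add (s t : ZMod 2) : signChar (s + t) = signChar s * signChar t := by
  rw [signChar, signChar, signChar, ← pow_add, ZMod.val_add]
  exact (neg_one_pow_eq_pow_mod_two _).symm

@[simp] theorem signChar_zero : signChar 0 = 1 := by simp [signChar]

@[simp] theorem signChar_one : signChar 1 = -1 := by simp [signChar, ZMod.val_one]

theorem signChar_mul_self (s : ZMod 2) : signChar s * signChar s = 1 := by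
  rw [← signChar_add, CharTwo.add_self_eq_zero, signChar_zero]

theorem signChar_ne_zero (s : ZMod 2) : signChar s ≠ 0 :=
  left_ne_zero_of_mul_eq_one (signChar_mul_self s)

theorem star_signChar (s : ZMod 2) : (starRingEnd ℂ) (signChar s) = signChar s := by
  simp [signChar]

theorem pauli_apply {n : ℕ} (u : SympVec n) (ψ : QubitSpace n) (x : Fin n → ZMod 2) :
    pauli u ψ x = signChar (u.2 ⬝ᵥ (x - u.1)) * ψ (x - u.1) := by
  have h : ∀ y, x = y + u.1 ↔ y = x - u.1 := fun y => by rw [eq_sub_iff_add_eq, eq_comm]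
  simp [pauli, Matrix.toLpLin_apply, Matrix.mulVec, dotProduct, h, signChar]

theorem pauli_pauli {n : ℕ} (u w : SympVec n) (ψ : QubitSpace n) :
    pauli u (pauli w ψ) = signChar (u.2 ⬝ᵥ w.1) • pauli (u + w) ψ := by
  ext x
  have h : x - u.1 - w.1 = x - (u + w).1 := by rw [Prod.fst_add, sub_sub]
  have h' : u.2 ⬝ᵥ (x - u.1) = u.2 ⬝ᵥ w.1 + u.2 ⬝ᵥ (x - (u + w).1) := by
    rw [← dotProduct_add, ← h, add_sub_cancel]
  rw [PiLp.smul_apply, pauli_apply, pauli_apply, pauli_apply, h, h', Prod.snd_add, add_dotProduct,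
    signChar_add, signChar_add, smul_eq_mul]
  ring

theorem pauli_zero {n : ℕ} (ψ : QubitSpace n) : pauli 0 ψ = ψ := by
  ext x
  simp [pauli_apply]

theorem pauli_self {n : ℕ} (u : SympVec n) (ψ : QubitSpace n) :
    pauli u (pauli u ψ) = signChar (u.2 ⬝ᵥ u.1) • ψ := by
  have h : u + u = 0 := 
    Prod.ext (funext fun _ => CharTwo.add_self_eq_zero _) (funext fun _ => CharTwo.add_self_eq_zero _)
  rw [pauli_pauli, congrArg pauli h, pauli_zero]

theorem pauli_comm {n : ℕ} (u w : SympVec n) (ψ : QubitSpace n) :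
    pauli u (pauli w ψ) = signChar (sympForm u w) • pauli w (pauli u ψ) := by
  have h : u.2 ⬝ᵥ w.1 = sympForm u w + w.2 ⬝ᵥ u.1 := by
    simp only [sympForm, dotProduct, ← Finset.sum_add_distrib, CharTwo.sub_eq_add]
    refine Finset.sum_congr rfl fun i _ => ?_
    linear_combination -(u.1 i * w.2 i) * CharTwo.two_eq_zero (R := ZMod 2)
  rw [pauli_pauli, pauli_pauli, smul_smul, h, signChar_add, add_comm w u]

theorem pauli_injective {n : ℕ} (u : SympVec n) : Function.Injective (pauli u) := by
  intro φ ψ h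
  have h' := congrArg (pauli u) h
  rw [pauli_self, pauli_self] at h'
  exact smul_right_injective _ (signChar_ne_zero _) h'

theorem inner_pauli_pauli {n : ℕ} (u : SympVec n) (φ ψ : QubitSpace n) :
    inner ℂ (pauli u φ) (pauli u ψ) = inner ℂ φ ψ := by
  simp only [PiLp.inner_apply, pauli_apply, RCLike.inner_apply]
  rw [← (Equiv.subRight u.1).sum_comp fun x => ψ x * (starRingEnd ℂ) (φ x)]
  refine Finset.sum_congr rfl fun x _ => ?_
  rw [Equiv.subRight_apply, map_mul, star_signChar]
  linear_combination (ψ (x - u.1) * (starRingEnd ℂ) (φ (x - u.1))) *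
    signChar_mul_self (u.2 ⬝ᵥ (x - u.1))

/-! ### Stabilizer codes -/

theorem eq_zero_of_eq_neg_self {V : Type*} [AddCommGroup V] [Module ℂ V] {x : V} (h : x = -x) :
    x = 0 := by
  have h2 : (2 : ℂ) • x = 0 := by rw [two_smul, ← eq_neg_iff_add_eq_zero, ← h]
  exact (smul_eq_zero.1 h2).resolve_left two_ne_zero

/-- The two eigenspaces of a Pauli operator on a subspace that it preserves have the same dimension,
if some Pauli operator that preserves the subspace anticommutes with it. -/
theorem exists_finrank_eigenspace_pauli {n : ℕ} (Q : Submodule ℂ (QubitSpace n)) (u w : SympVec n)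
    (hu : ∀ ψ ∈ Q, pauli u ψ ∈ Q) (hw : ∀ ψ ∈ Q, pauli w ψ ∈ Q) (huw : sympForm u w = 1) :
    ∃ c : ℂ, Module.finrank ℂ ↥(Q ⊓ Module.End.eigenspace (pauli u) c) * 2 = Module.finrank ℂ Q := by
  -- The square of `pauli u` is a sign, possibly $-1$, so its eigenvalues are $\pm c$ with $c$
  -- possibly $\pm i$.
  obtain ⟨c, hc⟩ := IsAlgClosed.exists_pow_nat_eq (signChar (u.2 ⬝ᵥ u.1)) two_pos
  have hc0 : c ≠ 0 := by
    rintro rfl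
    exact signChar_ne_zero _ (by rw [← hc]; ring)
  have hle : ∀ e : ℂ, Module.finrank ℂ ↥(Q ⊓ Module.End.eigenspace (pauli u) e) ≤
      Module.finrank ℂ ↥(Q ⊓ Module.End.eigenspace (pauli u) (-e)) := by
    -- By anticommutation `pauli w` carries the $e$-eigenspace injectively into the
    -- $(-e)$-eigenspace.
    intro e
    have hmap : ∀ ψ ∈ Q ⊓ Module.End.eigenspace (pauli u) e,
        pauli w ψ ∈ Q ⊓ Module.End.eigenspace (pauli u) (-e) := by
      intro ψ hψ
      refine ⟨hw _ hψ.1, Module.End.mem_eigenspace_iff.2 ?_⟩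
      rw [pauli_comm, huw, signChar_one, Module.End.mem_eigenspace_iff.1 hψ.2, map_smul, smul_smul,
        neg_one_mul]
    refine LinearMap.finrank_le_finrank_of_injective (f := (pauli w).restrict hmap) ?_
    exact fun x y h => Subtype.ext (pauli_injective w (congrArg Subtype.val h))
  have hsup : Q ⊓ Module.End.eigenspace (pauli u) c ⊔ Q ⊓ Module.End.eigenspace (pauli u) (-c) = Q := by
    refine le_antisymm (sup_le inf_le_left inf_le_left) fun ψ hψ => ?_
    -- Up to the factor $1/2$, this is the projection $(1+e^{-1}E)/2$ onto the $e$-eigenspace.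
    have hm : ∀ e : ℂ, e ^ 2 = c ^ 2 → ψ + e⁻¹ • pauli u ψ ∈ Q ⊓ Module.End.eigenspace (pauli u) e := by
      intro e he
      have he0 : e ≠ 0 := by
        rintro rfl
        exact hc0 (by simpa using he.symm)
      refine ⟨Q.add_mem hψ (Q.smul_mem _ (hu _ hψ)),
        Module.End.mem_eigenspace_iff.2 ?_⟩
      rw [map_add, map_smul, pauli_self, ← hc, ← he, smul_smul,
        smul_add, smul_smul, mul_inv_cancel₀ he0, one_smul, add_comm]
      congr 2
      field_simp
    have h2 : ψ = (2⁻¹ : ℂ) • (ψ + c⁻¹ • pauli u ψ) +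
        (2⁻¹ : ℂ) • (ψ + (-c)⁻¹ • pauli u ψ) := by
      rw [inv_neg]
      module
    rw [h2]
    exact Submodule.add_mem_sup (Submodule.smul_mem _ _ (hm c rfl))
      (Submodule.smul_mem _ _ (hm (-c) (neg_sq c)))
  have hinf : Q ⊓ Module.End.eigenspace (pauli u) c ⊓ (Q ⊓ Module.End.eigenspace (pauli u) (-c)) = ⊥ := by
    refine (Submodule.eq_bot_iff _).2 fun ψ hψ => ?_
    have h1 := Module.End.mem_eigenspace_iff.1 hψ.1.2
    have h2 := Module.End.mem_eigenspace_iff.1 hψ.2.2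
    rw [h1, neg_smul] at h2
    exact (smul_eq_zero.1 (eq_zero_of_eq_neg_self h2)).resolve_left hc0
  have h := Submodule.finrank_sup_add_finrank_inf_eq (Q ⊓ Module.End.eigenspace (pauli u) c)
    (Q ⊓ Module.End.eigenspace (pauli u) (-c))
  rw [hinf, finrank_bot, add_zero, hsup] at h
  have h1 := hle c
  have h2 := hle (-c)
  rw [neg_neg] at h2
  exact ⟨c, by rw [h, ← le_antisymm h1 h2, mul_two]⟩

/-- Induction on `r`: by independence some Pauli operator commutes with the other generators and
anticommutes with the new one, so the new one splits the previous eigenspace into equal halves. -/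
theorem exists_joint_eigenspace_pauli {n r : ℕ} (e : Fin r → SympVec n)
    (he : LinearIndependent (ZMod 2) e) (hiso : ∀ i j, sympForm (e i) (e j) = 0) :
    ∃ (c : Fin r → ℂ) (Q : Submodule ℂ (QubitSpace n)),
      Module.finrank ℂ Q * 2 ^ r = 2 ^ n ∧ ∀ ψ, ψ ∈ Q ↔ ∀ i, pauli (e i) ψ = c i • ψ := by
  induction r with
  | zero => exact ⟨0, ⊤, by simp, by simp⟩
  | succ r ih =>
    obtain ⟨he', hu⟩ := linearIndependent_finSucc.1 he
    obtain ⟨c, Q, hQ, hmem⟩ := ih (Fin.tail e) he' fun i j => hiso _ _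
    obtain ⟨w, hw, huw⟩ := exists_sympForm_eq_one hu
    have hpres : ∀ v, (∀ i, sympForm (Fin.tail e i) v = 0) → ∀ ψ ∈ Q, pauli v ψ ∈ Q := by
      intro v hv ψ hψ
      refine (hmem _).2 fun i => ?_
      rw [pauli_comm, hv, signChar_zero, one_smul, (hmem ψ).1 hψ i, map_smul]
    obtain ⟨a, ha⟩ := exists_finrank_eigenspace_pauli Q (e 0) w (hpres _ fun i => hiso _ _)
      (hpres _ fun i => hw _ (Submodule.subset_span ⟨i, rfl⟩)) huw
    refine ⟨Fin.cons a c, Q ⊓ Module.End.eigenspace (pauli (e 0)) a, ?_, fun ψ => ?_⟩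
    · rw [← hQ, ← ha, pow_succ]
      ring
    · rw [Submodule.mem_inf, hmem, Module.End.mem_eigenspace_iff, Fin.forall_fin_succ, and_comm]
      rfl

/-- The stabilizer code of a self-orthogonal binary code. -/
theorem exists_stabilizer_code {n : ℕ} (S : Submodule (ZMod 2) (SympVec n))
    (hS : S ≤ (sympBilin n).orthogonal S) :
    ∃ Q : Submodule ℂ (QubitSpace n),
      Module.finrank ℂ Q * 2 ^ Module.finrank (ZMod 2) S = 2 ^ n ∧
      (∀ u, DetectsPurely Q u ↔ u ∉ (sympBilin n).orthogonal S) ∧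
      ∀ u, Detects Q u ↔ (u ∈ S ∨ u ∉ (sympBilin n).orthogonal S) := by
  let b := Module.finBasis (ZMod 2) S
  have hspan : Submodule.span (ZMod 2) (Set.range fun i => (b i : SympVec n)) = S := by
    have h := congrArg (Submodule.map S.subtype) b.span_eq
    rwa [Submodule.map_span, ← Set.range_comp, Submodule.map_top, Submodule.range_subtype] at h
  obtain ⟨c, Q, hQ, hmem⟩ := exists_joint_eigenspace_pauli (fun i => (b i : SympVec n))
    (b.linearIndependent.map' S.subtype S.ker_subtype) fun i j => hS (b j).2 _ (b i).2
  have hQ0 : Q ≠ ⊥ := by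
    rintro rfl
    rw [finrank_bot, zero_mul] at hQ
    exact pow_ne_zero n two_ne_zero hQ.symm
  obtain ⟨ψ₀, hψ₀, hψ₀0⟩ := Submodule.exists_mem_ne_zero_of_ne_bot hQ0
  have hpres : ∀ v ∈ (sympBilin n).orthogonal S, ∀ ψ ∈ Q, pauli v ψ ∈ Q := by
    intro v hv ψ hψ
    refine (hmem _).2 fun i => ?_
    rw [pauli_comm, show sympForm (b i : SympVec n) v = 0 from hv _ (b i).2, signChar_zero,
      one_smul, (hmem ψ).1 hψ i, map_smul]
  have hscal : ∀ s ∈ S, ∃ a : ℂ, ∀ ψ ∈ Q, pauli s ψ = a • ψ := by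
    intro s hs
    rw [← hspan] at hs
    induction hs using Submodule.span_induction with
    | mem x hx =>
      obtain ⟨i, rfl⟩ := hx
      exact ⟨c i, fun ψ hψ => (hmem ψ).1 hψ i⟩
    | zero => exact ⟨1, fun ψ _ => by rw [pauli_zero, one_smul]⟩
    | add x y _ _ hx hy =>
      obtain ⟨a, ha⟩ := hx
      obtain ⟨a', ha'⟩ := hy
      -- The sign of `pauli_pauli` is its own inverse, so it can be moved to the scalar.
      refine ⟨signChar (x.2 ⬝ᵥ y.1) * (a' * a), fun ψ hψ => ?_⟩
      have h := pauli_pauli x y ψ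
      rw [ha' ψ hψ, map_smul, ha ψ hψ, smul_smul] at h
      rw [mul_smul, h, smul_smul, signChar_mul_self, one_smul]
    | smul t x _ hx =>
      obtain ⟨a, ha⟩ := hx
      by_cases ht : t = 0
      · exact ⟨1, fun ψ _ => by rw [ht, zero_smul, pauli_zero, one_smul]⟩
      · refine ⟨a, fun ψ hψ => ?_⟩
        rw [Fin.eq_one_of_ne_zero t ht]
        exact (congrArg (pauli · ψ) (one_smul (ZMod 2) x)).trans (ha ψ hψ)
  have hpure : ∀ u, u ∉ (sympBilin n).orthogonal S → DetectsPurely Q u := by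
    intro u hu φ hφ ψ hψ
    rw [LinearMap.BilinForm.mem_orthogonal_iff] at hu
    push Not at hu
    obtain ⟨s, hs, hsu⟩ := hu
    obtain ⟨a, ha⟩ := hscal s hs
    have haa : (starRingEnd ℂ) a * a = 1 := by
      have h := inner_pauli_pauli s ψ₀ ψ₀
      rw [ha _ hψ₀, inner_smul_left, inner_smul_right, ← mul_assoc] at h
      exact mul_right_cancel₀ (inner_self_ne_zero.2 hψ₀0) (h.trans (one_mul _).symm)
    -- For $s$ anticommuting with $u$, unitarity gives
    -- $\langle\varphi,E\psi\rangle=-|a|^2\langle\varphi,E\psi\rangle$ with $|a|=1$.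
    have h := inner_pauli_pauli s φ (pauli u ψ)
    rw [pauli_comm, show sympForm s u = 1 from Fin.eq_one_of_ne_zero _ hsu, signChar_one,
      ha _ hφ, ha _ hψ, map_smul, inner_smul_left, inner_smul_right, inner_smul_right] at h
    have h2 : (2 : ℂ) * inner ℂ φ (pauli u ψ) = 0 := by
      linear_combination -h - inner ℂ φ (pauli u ψ) * haa
    exact (mul_eq_zero.1 h2).resolve_left two_ne_zero
  have hnotpure : ∀ u ∈ (sympBilin n).orthogonal S, ¬ DetectsPurely Q u := by
    intro u hu h
    have h0 := h _ (hpres u hu ψ₀ hψ₀) ψ₀ hψ₀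
    rw [inner_self_eq_zero] at h0
    exact hψ₀0 (pauli_injective u (h0.trans (map_zero _).symm))
  refine ⟨Q, hQ, fun u => ⟨fun h hu => hnotpure u hu h, hpure u⟩, fun u => ⟨fun hd => ?_, ?_⟩⟩
  · by_contra! hcon
    obtain ⟨huS, hu⟩ := hcon
    obtain ⟨a, ha⟩ := hd
    -- The difference $E\psi-a\psi$ lies in $Q$ and is orthogonal to $Q$. But a scalar cannot
    -- anticommute with the `w` chosen next, which also preserves $Q$.
    have hev : ∀ ψ ∈ Q, pauli u ψ = a • ψ := by
      intro ψ hψ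
      rw [← sub_eq_zero, ← inner_self_eq_zero (𝕜 := ℂ)]
      have hd := Q.sub_mem (hpres u hu ψ hψ) (Q.smul_mem a hψ)
      rw [inner_sub_right, ha _ hd _ hψ, inner_smul_right, sub_self]
    obtain ⟨w, hw, huw⟩ := exists_sympForm_eq_one huS
    have h := pauli_comm u w ψ₀
    rw [huw, signChar_one, hev _ (hpres w hw _ hψ₀), hev _ hψ₀, map_smul, neg_one_smul] at h
    have h0 := eq_zero_of_eq_neg_self h
    rw [← map_smul, ← hev _ hψ₀] at h0
    exact hψ₀0 (pauli_injective u (pauli_injective w (by rw [h0, map_zero, map_zero])))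
  · rintro (hu | hu)
    · obtain ⟨a, ha⟩ := hscal u hu
      exact ⟨a, fun φ _ ψ hψ => by rw [ha _ hψ, inner_smul_right]⟩
    · exact ⟨0, fun φ hφ ψ hψ => by rw [hpure u hu φ hφ ψ hψ, zero_mul]⟩

/-! ### The ring $\mathbb F_2[x]/\langle x^n-1\rangle$ and its involution -/

theorem finrank_adjoinRoot {g : (ZMod 2)[X]} (hg : g ≠ 0) :
    Module.finrank (ZMod 2) (AdjoinRoot g) = g.natDegree := by
  rw [(AdjoinRoot.powerBasis hg).finrank, AdjoinRoot.powerBasis_dim]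

theorem natDegree_X_pow_sub_one (n : ℕ) : (X ^ n - 1 : (ZMod 2)[X]).natDegree = n := by
  simpa using natDegree_X_pow_sub_C (n := n) (r := (1 : ZMod 2))

theorem X_pow_sub_one_ne_zero' {n : ℕ} (hn : 0 < n) : (X ^ n - 1 : (ZMod 2)[X]) ≠ 0 :=
  X_pow_sub_C_ne_zero hn 1

theorem finrank_cycRing {n : ℕ} (hn : 0 < n) : Module.finrank (ZMod 2) (CycRing n) = n := by
  rw [finrank_adjoinRoot (X_pow_sub_one_ne_zero' hn), natDegree_X_pow_sub_one]

theorem finite_cycRing {n : ℕ} (hn : 0 < n) : Module.Finite (ZMod 2) (CycRing n) :=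
  (AdjoinRoot.powerBasis (X_pow_sub_one_ne_zero' hn)).finite

theorem vecToRing_apply {n : ℕ} (a : Fin n → ZMod 2) :
    vecToRing n a = ∑ i, a i • AdjoinRoot.root (X ^ n - 1 : (ZMod 2)[X]) ^ (i : ℕ) := rfl

theorem vecToRing_injective {n : ℕ} (hn : 0 < n) : Function.Injective (vecToRing n) := by
  have h := (AdjoinRoot.powerBasis (X_pow_sub_one_ne_zero' hn)).basis.linearIndependent
  rw [PowerBasis.coe_basis] at h
  have hd : n = (AdjoinRoot.powerBasis (X_pow_sub_one_ne_zero' hn)).dim := by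
    rw [AdjoinRoot.powerBasis_dim, natDegree_X_pow_sub_one]
  exact LinearIndependent.fintypeLinearCombination_injective (h.comp (Fin.cast hd) (Fin.cast_injective hd))

/-- Vectors of length `n` and elements of `F₂[x] / ⟨xⁿ - 1⟩` correspond to each other. -/
noncomputable def vecEquivRing {n : ℕ} (hn : 0 < n) : (Fin n → ZMod 2) ≃ₗ[ZMod 2] CycRing n :=
  have := finite_cycRing hn
  LinearEquiv.ofInjectiveOfFinrankEq (vecToRing n) (vecToRing_injective hn)
    (by rw [finrank_cycRing hn, Module.finrank_fin_fun])

theorem vecEquivRing_apply {n : ℕ} (hn : 0 < n) (a : Fin n → ZMod 2) :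
    vecEquivRing hn a = vecToRing n a := rfl

theorem root_pow_card (n : ℕ) : AdjoinRoot.root (X ^ n - 1 : (ZMod 2)[X]) ^ n = 1 := by
  rw [← sub_eq_zero, ← AdjoinRoot.mk_X, ← map_pow, ← map_one (AdjoinRoot.mk _), ← map_sub,
    AdjoinRoot.mk_self]

/-- The coefficient of `1`. -/
noncomputable def constCoeff {n : ℕ} (hn : 0 < n) : CycRing n →ₗ[ZMod 2] ZMod 2 :=
  LinearMap.proj ⟨0, hn⟩ ∘ₗ (vecEquivRing hn).symm.toLinearMap

theorem constCoeff_root_pow {n : ℕ} (hn : 0 < n) (m : ℕ) :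
    constCoeff hn (AdjoinRoot.root (X ^ n - 1 : (ZMod 2)[X]) ^ m) = if n ∣ m then 1 else 0 := by
  have h : AdjoinRoot.root (X ^ n - 1 : (ZMod 2)[X]) ^ m =
      vecEquivRing hn (Pi.single ⟨m % n, Nat.mod_lt _ hn⟩ 1) := by
    rw [vecEquivRing_apply, vecToRing_apply]
    simp only [Pi.single_apply, ite_smul, one_smul, zero_smul, Finset.sum_ite_eq',
      Finset.mem_univ, if_true]
    conv_lhs => rw [← Nat.mod_add_div m n, pow_add, pow_mul, root_pow_card, one_pow, mul_one]
  rw [h, constCoeff, LinearMap.comp_apply, LinearEquiv.coe_coe, LinearEquiv.symm_apply_apply,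
    LinearMap.proj_apply, Pi.single_apply]
  simp only [Fin.mk.injEq, Nat.dvd_iff_mod_eq_zero, eq_comm]

/-- The ring endomorphism `x ↦ x⁻¹` of `F₂[x] / ⟨xⁿ - 1⟩`. -/
noncomputable def cycBar (n : ℕ) : CycRing n →ₐ[ZMod 2] CycRing n :=
  AdjoinRoot.liftAlgHom _ (Algebra.ofId _ _)
    (AdjoinRoot.root (X ^ n - 1 : (ZMod 2)[X]) ^ (n - 1)) (by
      rw [eval₂_sub, eval₂_pow, eval₂_X, eval₂_one, ← pow_mul, mul_comm, pow_mul, root_pow_card,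
        one_pow, sub_self])

theorem cycBar_root (n : ℕ) : cycBar n (AdjoinRoot.root (X ^ n - 1)) =
    AdjoinRoot.root (X ^ n - 1 : (ZMod 2)[X]) ^ (n - 1) :=
  AdjoinRoot.liftAlgHom_root ..

theorem cycBar_root_mul {n : ℕ} (hn : 0 < n) :
    cycBar n (AdjoinRoot.root (X ^ n - 1)) * AdjoinRoot.root (X ^ n - 1) = 1 := by
  rw [cycBar_root, ← pow_succ, Nat.sub_add_cancel hn, root_pow_card]

theorem cycBar_cycBar {n : ℕ} (hn : 0 < n) (y : CycRing n) : cycBar n (cycBar n y) = y := by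
  have h : (cycBar n).comp (cycBar n) = AlgHom.id (ZMod 2) (CycRing n) := by
    refine AdjoinRoot.algHom_ext ?_
    have h1 := cycBar_root_mul hn
    have h2 := congrArg (cycBar n) h1
    rw [map_mul, map_one] at h2
    rw [AlgHom.comp_apply, AlgHom.id_apply]
    linear_combination AdjoinRoot.root _ * h2 - cycBar n (cycBar n (AdjoinRoot.root _)) * h1
  exact DFunLike.congr_fun h y

theorem cycBar_mk {n : ℕ} (p : (ZMod 2)[X]) :
    cycBar n (AdjoinRoot.mk _ p) = aeval (cycBar n (AdjoinRoot.root (X ^ n - 1))) p := by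
  rw [← AdjoinRoot.aeval_eq, aeval_algHom_apply]

/-- This decides when $x^i\,\overline{x^j}=x^{i+(n-1)j}$ has constant coefficient $1$. -/
theorem dvd_add_pred_mul_iff {n i j : ℕ} (hi : i < n) (hj : j < n) :
    n ∣ i + (n - 1) * j ↔ i = j := by
  have h : ((i + (n - 1) * j : ℕ) : ℤ) = (i - j) + n * j := by
    rw [Nat.cast_add, Nat.cast_mul, Nat.cast_sub (by lia)]
    push_cast
    ring
  rw [← Int.natCast_dvd_natCast, h, Int.dvd_add_left (dvd_mul_right _ _)]
  constructor
  · intro hd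
    have := Int.eq_zero_of_abs_lt_dvd hd (by rw [abs_lt]; lia)
    lia
  · rintro rfl
    simp

theorem constCoeff_mul_cycBar {n : ℕ} (hn : 0 < n) (a b : Fin n → ZMod 2) :
    constCoeff hn (vecToRing n a * cycBar n (vecToRing n b)) = ∑ i, a i * b i := by
  simp only [vecToRing_apply, map_sum, map_smul, map_pow, cycBar_root, Finset.sum_mul_sum,
    smul_mul_smul_comm, ← pow_mul, ← pow_add, constCoeff_root_pow]
  refine Finset.sum_congr rfl fun i _ => ?_
  simp only [dvd_add_pred_mul_iff i.2 (Fin.is_lt _), Fin.val_inj]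
  simp

/-- Taking `r` to be the powers of $x$ reads off the coefficients of $\bar y$ one by one. -/
theorem eq_zero_of_constCoeff_mul {n : ℕ} (hn : 0 < n) {y : CycRing n}
    (h : ∀ r, constCoeff hn (r * y) = 0) : y = 0 := by
  obtain ⟨a, ha⟩ := (vecEquivRing hn).surjective (cycBar n y)
  have hy : cycBar n (vecToRing n a) = y := by
    rw [← vecEquivRing_apply hn, ha, cycBar_cycBar hn]
  have h0 : a = 0 := by
    ext i
    have h := h (vecToRing n (Pi.single i 1))
    rw [← hy, constCoeff_mul_cycBar] at h
    simpa [Pi.single_apply] using h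
  rw [← hy, h0, map_zero, map_zero]

theorem sympForm_eq_constCoeff {n : ℕ} (hn : 0 < n) (u w : SympVec n) :
    sympForm u w = constCoeff hn (vecToRing n u.1 * cycBar n (vecToRing n w.2) -
      vecToRing n u.2 * cycBar n (vecToRing n w.1)) := by
  rw [map_sub, constCoeff_mul_cycBar, constCoeff_mul_cycBar, sympForm, Finset.sum_sub_distrib]

/-- The involution sends $x^j$ to $x^{(n-j)\bmod n}$, which is how `barPoly` permutes coefficients;
the degree bound keeps all exponents of $v$ below $n$. -/
theorem cycBar_mk_of_barPoly_eq {n : ℕ} (hn : 0 < n) {v : (ZMod 2)[X]} (hv : v.degree < n)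
    (hbar : barPoly n v = v) : cycBar n (AdjoinRoot.mk _ v) = AdjoinRoot.mk _ v := by
  have hnd : v.natDegree < n := by
    rcases eq_or_ne v 0 with rfl | h0
    · simpa using hn
    · exact (natDegree_lt_iff_degree_lt h0).2 hv
  have hinv : ∀ j < n, (n - (n - j) % n) % n = j := by
    intro j hj
    rcases Nat.eq_zero_or_pos j with rfl | h0
    · simp
    · rw [Nat.mod_eq_of_lt (show n - j < n by lia), Nat.sub_sub_self hj.le, Nat.mod_eq_of_lt hj]
  have hpow : ∀ j < n, cycBar n (AdjoinRoot.root (X ^ n - 1)) ^ j =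
      AdjoinRoot.root (X ^ n - 1) ^ ((n - j) % n) := by
    intro j hj
    rcases Nat.eq_zero_or_pos j with rfl | h0
    · simp
    · rw [Nat.mod_eq_of_lt (show n - j < n by lia)]
      have h1 := congrArg (· ^ j) (cycBar_root_mul hn)
      have h2 : AdjoinRoot.root (X ^ n - 1 : (ZMod 2)[X]) ^ (n - j) * AdjoinRoot.root _ ^ j = 1 := by
        rw [← pow_add, Nat.sub_add_cancel hj.le, root_pow_card]
      simp only [mul_pow, one_pow] at h1
      linear_combination AdjoinRoot.root (X ^ n - 1) ^ (n - j) * h1 -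
        cycBar n (AdjoinRoot.root (X ^ n - 1)) ^ j * h2
  conv_rhs => rw [← hbar, barPoly]
  rw [cycBar_mk, aeval_eq_sum_range' hnd, map_sum]
  refine Finset.sum_nbij' (fun j => (n - j) % n) (fun j => (n - j) % n) ?_ ?_ ?_ ?_ ?_
  · exact fun j _ => Finset.mem_range.2 (Nat.mod_lt _ hn)
  · exact fun j _ => Finset.mem_range.2 (Nat.mod_lt _ hn)
  · exact fun j hj => hinv j (Finset.mem_range.1 hj)
  · exact fun j hj => hinv j (Finset.mem_range.1 hj)
  · intro j hj
    rw [hinv j (Finset.mem_range.1 hj), map_mul, map_pow, AdjoinRoot.mk_X, AdjoinRoot.mk_C,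
      Algebra.smul_def, AdjoinRoot.algebraMap_eq, hpow j (Finset.mem_range.1 hj)]

/-- Since $x$ is a unit with inverse $\bar x$, this makes $g^\perp$ an associate of $\bar h$ in
$\mathcal R$. -/
theorem mk_reverse {n : ℕ} (hn : 0 < n) (h : (ZMod 2)[X]) :
    AdjoinRoot.mk (X ^ n - 1) h.reverse =
      AdjoinRoot.root (X ^ n - 1) ^ h.natDegree * cycBar n (AdjoinRoot.mk _ h) := by
  let _ : Invertible (cycBar n (AdjoinRoot.root (X ^ n - 1 : (ZMod 2)[X]))) :=
    ⟨AdjoinRoot.root _, by rw [mul_comm, cycBar_root_mul hn], cycBar_root_mul hn⟩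
  have key := eval₂_reverse_mul_pow (algebraMap (ZMod 2) (CycRing n))
    (cycBar n (AdjoinRoot.root (X ^ n - 1 : (ZMod 2)[X]))) h
  rw [cycBar_mk, aeval_def, ← key, ← AdjoinRoot.aeval_eq, aeval_def,
    mul_left_comm, ← mul_pow, mul_comm (AdjoinRoot.root _), cycBar_root_mul hn, one_pow, mul_one]
  rfl

theorem mk_dvd_iff_mul_eq_zero {n : ℕ} (hn : 0 < n) {g h : (ZMod 2)[X]} (hgh : g * h = X ^ n - 1)
    (y : CycRing n) : AdjoinRoot.mk _ g ∣ y ↔ y * AdjoinRoot.mk _ h = 0 := by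
  constructor
  · rintro ⟨r, rfl⟩
    rw [mul_right_comm, ← map_mul, hgh, AdjoinRoot.mk_self, zero_mul]
  · induction y using AdjoinRoot.induction_on with
    | ih p =>
      intro h0
      rw [← map_mul, AdjoinRoot.mk_eq_zero, ← hgh] at h0
      have hh : h ≠ 0 := by
        rintro rfl
        exact X_pow_sub_one_ne_zero' hn (by rw [← hgh, mul_zero])
      exact map_dvd _ ((mul_dvd_mul_iff_right hh).1 h0)

theorem mk_dvd_mk_iff {n : ℕ} {g : (ZMod 2)[X]} (hg : g ∣ X ^ n - 1) (p : (ZMod 2)[X]) :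
    AdjoinRoot.mk (X ^ n - 1) g ∣ AdjoinRoot.mk (X ^ n - 1) p ↔ g ∣ p := by
  refine ⟨?_, map_dvd _⟩
  rintro ⟨r, hr⟩
  induction r using AdjoinRoot.induction_on with
  | ih q =>
    rw [← map_mul, AdjoinRoot.mk_eq_mk] at hr
    have h := dvd_add (hg.trans hr) (dvd_mul_right g q)
    rwa [sub_add_cancel] at h

/-- The ideal is the kernel of the surjection $\mathcal R\to\mathbb F_2[x]/\langle g\rangle$. -/
theorem finrank_span_mk {n : ℕ} (hn : 0 < n) {g : (ZMod 2)[X]} (hg : g ∣ X ^ n - 1) :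
    Module.finrank (ZMod 2)
      ((Ideal.span {AdjoinRoot.mk (X ^ n - 1) g}).restrictScalars (ZMod 2)) + g.natDegree = n := by
  have hg0 : g ≠ 0 := ne_zero_of_dvd_ne_zero (X_pow_sub_one_ne_zero' hn) hg
  have := finite_cycRing hn
  let f : CycRing n →ₗ[ZMod 2] AdjoinRoot g :=
    (AdjoinRoot.algHomOfDvd (ZMod 2) (X ^ n - 1) g hg).toLinearMap
  have hf : ∀ p, f (AdjoinRoot.mk _ p) = AdjoinRoot.mk g p := by
    intro p
    rw [← AdjoinRoot.aeval_eq, ← AdjoinRoot.aeval_eq,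
      ← AdjoinRoot.algHomOfDvd_root (R := ZMod 2) (X ^ n - 1) g hg]
    exact (aeval_algHom_apply (AdjoinRoot.algHomOfDvd (ZMod 2) (X ^ n - 1) g hg) _ p).symm
  have hsurj : LinearMap.range f = ⊤ := by
    refine LinearMap.range_eq_top.2 fun y => ?_
    obtain ⟨p, rfl⟩ := AdjoinRoot.mk_surjective y
    exact ⟨_, hf p⟩
  have hker : LinearMap.ker f =
      (Ideal.span {AdjoinRoot.mk (X ^ n - 1) g}).restrictScalars (ZMod 2) := by
    ext y
    obtain ⟨p, rfl⟩ := AdjoinRoot.mk_surjective y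
    rw [LinearMap.mem_ker, hf, AdjoinRoot.mk_eq_zero, Submodule.restrictScalars_mem,
      Ideal.mem_span_singleton, mk_dvd_mk_iff hg]
  have h := f.finrank_range_add_finrank_ker
  rw [hsurj, finrank_top, finrank_adjoinRoot hg0, hker, finrank_cycRing hn] at h
  lia

/-! ### The quasi-cyclic code: dimension and dual -/

theorem mem_twoGenQCCode {n : ℕ} {g₁ g₂ v : (ZMod 2)[X]} {u : SympVec n} :
    u ∈ twoGenQCCode n g₁ g₂ v ↔ ∃ a b : CycRing n, AdjoinRoot.mk _ g₁ ∣ a ∧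
      AdjoinRoot.mk _ g₂ ∣ b ∧ AdjoinRoot.mk _ v * a + b = vecToRing n u.1 ∧
      a + AdjoinRoot.mk _ v * b = vecToRing n u.2 := by
  rw [twoGenQCCode, Submodule.mem_comap, Submodule.restrictScalars_mem, Submodule.mem_span_pair]
  simp only [Prod.smul_mk, Prod.mk_add_mk, smul_eq_mul, map_mul, LinearMap.prodMap_apply,
    Prod.mk.injEq]
  constructor
  · rintro ⟨r, s, h1, h2⟩
    refine ⟨_, _, dvd_mul_left _ r, dvd_mul_left _ s, ?_, ?_⟩
    · rw [← h1]
      ring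
    · rw [← h2]
      ring
  · rintro ⟨_, _, ⟨r, rfl⟩, ⟨s, rfl⟩, h1, h2⟩
    refine ⟨r, s, ?_, ?_⟩
    · rw [← h1]
      ring
    · rw [← h2]
      ring

/-- In characteristic $2$ this element, the determinant of the coordinate change
$(a,b)\mapsto(va+b,a+vb)$, is $(v-1)^2$. -/
theorem isUnit_mk_sq_sub_one {n : ℕ} {v : (ZMod 2)[X]} (hv1 : IsCoprime (v - 1) (X ^ n - 1)) :
    IsUnit (AdjoinRoot.mk (X ^ n - 1) v ^ 2 - 1) := by
  have hu : IsUnit (AdjoinRoot.mk (X ^ n - 1) v - 1) := by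
    have h := hv1.map (AdjoinRoot.mk (X ^ n - 1))
    rwa [AdjoinRoot.mk_self, isCoprime_zero_right, map_sub, map_one] at h
  have h2 : (2 : CycRing n) = 0 := by
    have h := congrArg (algebraMap (ZMod 2) (CycRing n)) (CharTwo.two_eq_zero (R := ZMod 2))
    rwa [map_ofNat, map_zero] at h
  have h : AdjoinRoot.mk (X ^ n - 1) v ^ 2 - 1 = (AdjoinRoot.mk (X ^ n - 1) v - 1) ^ 2 := by
    linear_combination (AdjoinRoot.mk (X ^ n - 1) v - 1) * h2
  rw [h]
  exact hu.pow 2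

theorem finrank_twoGenQCCode {n : ℕ} (hn : 0 < n) {g₁ g₂ v : (ZMod 2)[X]}
    (hg₁ : g₁ ∣ X ^ n - 1) (hg₂ : g₂ ∣ X ^ n - 1) (hv1 : IsCoprime (v - 1) (X ^ n - 1)) :
    Module.finrank (ZMod 2) (twoGenQCCode n g₁ g₂ v) + (g₁.natDegree + g₂.natDegree) = 2 * n := by
  have := finite_cycRing hn
  let I := fun g : (ZMod 2)[X] =>
    (Ideal.span {AdjoinRoot.mk (X ^ n - 1) g}).restrictScalars (ZMod 2)
  let p : I g₁ × I g₂ →ₗ[ZMod 2] CycRing n := (I g₁).subtype ∘ₗ LinearMap.fst _ _ _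
  let q : I g₁ × I g₂ →ₗ[ZMod 2] CycRing n := (I g₂).subtype ∘ₗ LinearMap.snd _ _ _
  let m : CycRing n →ₗ[ZMod 2] CycRing n := LinearMap.mulLeft _ (AdjoinRoot.mk _ v)
  let f : I g₁ × I g₂ →ₗ[ZMod 2] SympVec n :=
    ((vecEquivRing hn).symm.toLinearMap ∘ₗ (m ∘ₗ p + q)).prod
      ((vecEquivRing hn).symm.toLinearMap ∘ₗ (p + m ∘ₗ q))
  have hf : ∀ (x : I g₁ × I g₂) (u : SympVec n), f x = u ↔
      AdjoinRoot.mk _ v * (x.1 : CycRing n) + (x.2 : CycRing n) = vecToRing n u.1 ∧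
      (x.1 : CycRing n) + AdjoinRoot.mk _ v * (x.2 : CycRing n) = vecToRing n u.2 := by
    intro x u
    rw [Prod.ext_iff, ← vecEquivRing_apply hn, ← vecEquivRing_apply hn,
      ← LinearEquiv.symm_apply_eq, ← LinearEquiv.symm_apply_eq]
    rfl
  have hinj : Function.Injective f := by
    rw [← LinearMap.ker_eq_bot, LinearMap.ker_eq_bot']
    rintro ⟨x, y⟩ hx
    rw [hf] at hx
    simp only [Prod.fst_zero, Prod.snd_zero, map_zero] at hx
    have hu := isUnit_mk_sq_sub_one hv1
    refine Prod.ext (Subtype.ext (hu.mul_right_eq_zero.1 ?_))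
      (Subtype.ext (hu.mul_right_eq_zero.1 ?_))
    · linear_combination AdjoinRoot.mk _ v * hx.1 - hx.2
    · linear_combination AdjoinRoot.mk _ v * hx.2 - hx.1
  have hrange : LinearMap.range f = twoGenQCCode n g₁ g₂ v := by
    ext u
    rw [mem_twoGenQCCode, LinearMap.mem_range]
    constructor
    · rintro ⟨x, hx⟩
      exact ⟨x.1, x.2, Ideal.mem_span_singleton.1 x.1.2, Ideal.mem_span_singleton.1 x.2.2,
        (hf x u).1 hx⟩
    · rintro ⟨a, b, ha, hb, h⟩
      exact ⟨⟨⟨a, Ideal.mem_span_singleton.2 ha⟩, ⟨b, Ideal.mem_span_singleton.2 hb⟩⟩,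
        (hf _ u).2 h⟩
  have h := LinearMap.finrank_range_of_inj hinj
  rw [hrange, Module.finrank_prod] at h
  have h1 : Module.finrank (ZMod 2) (I g₁) + g₁.natDegree = n := finrank_span_mk hn hg₁
  have h2 : Module.finrank (ZMod 2) (I g₂) + g₂.natDegree = n := finrank_span_mk hn hg₂
  rw [h, add_add_add_comm, h1, h2, two_mul]

theorem orthogonal_twoGenQCCode_le {n : ℕ} (hn : 0 < n) {g₁ g₂ v : (ZMod 2)[X]}
    (hg₁ : g₁ ∣ X ^ n - 1) (hv : v.degree < n) (hv1 : IsCoprime (v - 1) (X ^ n - 1))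
    (hperp : g₂ ∣ perpPoly n g₁) (hbar : barPoly n v = v) :
    (sympBilin n).orthogonal (twoGenQCCode n g₁ g₂ v) ≤ twoGenQCCode n g₁ g₂ v := by
  intro w hw
  have hbv := cycBar_mk_of_barPoly_eq hn hv hbar
  have hg₁0 : g₁ ≠ 0 := ne_zero_of_dvd_ne_zero (X_pow_sub_one_ne_zero' hn) hg₁
  obtain ⟨h, hgh⟩ := hg₁
  have hgh' : g₁ * h = X ^ n - 1 := hgh.symm
  have hdvd : AdjoinRoot.mk (X ^ n - 1) g₂ ∣ cycBar n (AdjoinRoot.mk _ h) := by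
    rw [perpPoly, hgh, mul_div_cancel_left₀ h hg₁0] at hperp
    have h1 := map_dvd (AdjoinRoot.mk (X ^ n - 1)) hperp
    rw [mk_reverse hn] at h1
    have h2 := h1.mul_left (cycBar n (AdjoinRoot.root (X ^ n - 1)) ^ h.natDegree)
    rwa [← mul_assoc, ← mul_pow, cycBar_root_mul hn, one_pow, one_mul] at h2
  have horth : ∀ a b : CycRing n, AdjoinRoot.mk _ g₁ ∣ a → AdjoinRoot.mk _ g₂ ∣ b →
      (AdjoinRoot.mk _ v * a + b) * cycBar n (vecToRing n w.2) -
        (a + AdjoinRoot.mk _ v * b) * cycBar n (vecToRing n w.1) = 0 := by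
    intro a b ha hb
    -- The code is closed under multiplication by `r`, so every constant coefficient vanishes, not
    -- only the one for `r = 1`.
    refine eq_zero_of_constCoeff_mul hn fun r => ?_
    obtain ⟨x, hx⟩ := (vecEquivRing hn).surjective (AdjoinRoot.mk _ v * (r * a) + r * b)
    obtain ⟨y, hy⟩ := (vecEquivRing hn).surjective (r * a + AdjoinRoot.mk _ v * (r * b))
    rw [vecEquivRing_apply] at hx hy
    have h0 : sympForm (x, y) w = 0 :=
      hw _ (mem_twoGenQCCode.2 ⟨_, _, ha.mul_left r, hb.mul_left r, hx.symm, hy.symm⟩)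
    rw [sympForm_eq_constCoeff hn, hx, hy] at h0
    rw [← h0]
    congr 1
    ring
  have e1 := horth _ 0 dvd_rfl (dvd_zero _)
  have e2 := horth 0 _ (dvd_zero _) dvd_rfl
  set V := AdjoinRoot.mk (X ^ n - 1) v
  set W₁ := vecToRing n w.1
  set W₂ := vecToRing n w.2
  -- The first generator gives $g_1\overline{(vW_2-W_1)}=0$, so $\bar h$ divides $vW_2-W_1$, and
  -- $g_2\mid\bar h$.
  have d2 : AdjoinRoot.mk _ g₂ ∣ V * W₂ - W₁ := by
    have h1 : AdjoinRoot.mk _ h ∣ cycBar n (V * W₂ - W₁) := by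
      rw [mk_dvd_iff_mul_eq_zero hn ((mul_comm _ _).trans hgh'), map_sub, map_mul, hbv]
      linear_combination e1
    have h2 := map_dvd (cycBar n) h1
    rw [cycBar_cycBar hn] at h2
    exact hdvd.trans h2
  -- The second generator gives $g_2\overline{(W_2-vW_1)}=0$; its multiple $\bar h$ also
  -- annihilates, and applying the bar gives $h(W_2-vW_1)=0$.
  have d1 : AdjoinRoot.mk _ g₁ ∣ W₂ - V * W₁ := by
    rw [mk_dvd_iff_mul_eq_zero hn hgh', ← cycBar_cycBar hn ((W₂ - V * W₁) * _)]
    obtain ⟨t, ht⟩ := hdvd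
    have h0 : cycBar n ((W₂ - V * W₁) * AdjoinRoot.mk _ h) = 0 := by
      rw [map_mul, ht, map_sub, map_mul, hbv]
      linear_combination t * e2
    rw [h0, map_zero]
  obtain ⟨c, hc⟩ := (isUnit_mk_sq_sub_one hv1).exists_left_inv
  -- Cramer's rule for $va+b=W_1$, $a+vb=W_2$, with $c=(v^2-1)^{-1}$.
  refine mem_twoGenQCCode.2 ⟨-c * (W₂ - V * W₁), c * (V * W₂ - W₁), d1.mul_left _, d2.mul_left _,
    ?_, ?_⟩
  · linear_combination W₁ * hc
  · linear_combination W₂ * hc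

/-! ### The main theorem -/

theorem mainTheorem1 (n : ℕ) (hn : 0 < n) (g₁ g₂ v : Polynomial (ZMod 2))
    (hg₁ : g₁ ∣ Polynomial.X ^ n - 1) (hg₂ : g₂ ∣ Polynomial.X ^ n - 1)
    (hv : v.degree < n)
    (hcop : IsCoprime g₁ g₂)
    (hv1 : IsCoprime (v - 1) (Polynomial.X ^ n - 1))
    (hperp : g₂ ∣ perpPoly n g₁)
    (hbar : barPoly n v = v) :
    g₁.natDegree + g₂.natDegree ≤ n ∧
    ∃ d : ℕ, IsMinSympWt (twoGenQCCode n g₁ g₂ v) d ∧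
      ∃ Q : Submodule ℂ (QubitSpace n),
        IsPureQuantumCode n (n - g₁.natDegree - g₂.natDegree) d Q ∧
        (∀ δ : ℕ, HasMinDistance Q δ → d ≤ δ) ∧
        (HasMinDistance Q d ↔
          n - g₁.natDegree - g₂.natDegree = 0 ∨
            ∃ u ∈ twoGenQCCode n g₁ g₂ v,
              u ∉ sympDual (twoGenQCCode n g₁ g₂ v) ∧ sympWt u = d) := by
  have hle := orthogonal_twoGenQCCode_le hn hg₁ hv hv1 hperp hbar
  have hfin := finrank_twoGenQCCode hn hg₁ hg₂ hv1
  set C := twoGenQCCode n g₁ g₂ v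
  have hCC : (sympBilin n).orthogonal ((sympBilin n).orthogonal C) = C :=
    LinearMap.BilinForm.orthogonal_orthogonal (sympBilin_nondegenerate n)
      (sympBilin_isAlt n).isRefl C
  have hS : Module.finrank (ZMod 2) ((sympBilin n).orthogonal C) =
      g₁.natDegree + g₂.natDegree := by
    rw [LinearMap.BilinForm.finrank_orthogonal (sympBilin_nondegenerate n), Module.finrank_prod,
      Module.finrank_fin_fun]
    lia
  have hdeg : g₁.natDegree + g₂.natDegree ≤ n := by
    have h := Submodule.finrank_mono hle
    rw [hS] at h
    lia
  obtain ⟨Q, hQ, hpure, hdet⟩ := exists_stabilizer_code ((sympBilin n).orthogonal C)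
    (hle.trans_eq hCC.symm)
  rw [hCC] at hpure hdet
  rw [hS] at hQ
  have hdim : Module.finrank ℂ Q = 2 ^ (n - g₁.natDegree - g₂.natDegree) := by
    refine Nat.eq_of_mul_eq_mul_right (pow_pos two_pos (g₁.natDegree + g₂.natDegree)) ?_
    rw [hQ, ← pow_add, Nat.sub_sub, Nat.sub_add_cancel hdeg]
  have hpureDist : ∀ d, HasPureDistance Q d ↔ IsMinSympWt C d := by
    intro d
    have hset : {t | ∃ u : SympVec n, u ≠ 0 ∧ ¬ DetectsPurely Q u ∧ sympWt u = t} =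
        {t | ∃ u ∈ C, u ≠ 0 ∧ sympWt u = t} := by
      ext t
      simp only [Set.mem_ofPred_eq, hpure, not_not]
      exact exists_congr fun u => and_left_comm
    rw [HasPureDistance, IsMinSympWt, hset]
  have hne : {t | ∃ u ∈ C, u ≠ 0 ∧ sympWt u = t}.Nonempty := by
    have hC : C ≠ ⊥ := by
      intro h
      rw [h, finrank_bot] at hfin
      lia
    obtain ⟨u, hu, hu0⟩ := Submodule.exists_mem_ne_zero_of_ne_bot hC
    exact ⟨_, u, hu, hu0, rfl⟩
  obtain ⟨d, hd⟩ : ∃ d, IsMinSympWt C d := ⟨_, Nat.sInf_mem hne, fun _ => Nat.sInf_le⟩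
  refine ⟨hdeg, d, hd, Q, ⟨hdim, (hpureDist d).2 hd⟩, ?_⟩
  have hone : Module.finrank ℂ Q = 1 ↔ n - g₁.natDegree - g₂.natDegree = 0 := by
    rw [hdim, Nat.pow_eq_one]
    simp
  by_cases hk : n - g₁.natDegree - g₂.natDegree = 0
  -- For $k=0$ the one-dimensional convention makes the minimum distance the pure distance.
  · simp only [HasMinDistance, if_pos (hone.2 hk), hpureDist]
    exact ⟨fun δ hδ => (hd.unique hδ).le, fun _ => Or.inl hk, fun _ => hd⟩
  · have hset : {t | ∃ u : SympVec n, ¬ Detects Q u ∧ sympWt u = t} =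
        {t | ∃ u ∈ C, u ∉ sympDual C ∧ sympWt u = t} := by
      ext t
      simp only [Set.mem_ofPred_eq, hdet, not_or, not_not, ← coe_orthogonal_sympBilin,
        SetLike.mem_coe]
      exact exists_congr fun u => by tauto
    have hlow : d ∈ lowerBounds {t | ∃ u ∈ C, u ∉ sympDual C ∧ sympWt u = t} := by
      rintro t ⟨u, hu, hus, rfl⟩
      refine hd.2 ⟨u, hu, ?_, rfl⟩
      rintro rfl
      exact hus ((sympBilin n).orthogonal C).zero_mem
    simp only [HasMinDistance, if_neg (mt hone.1 hk), hset]
    exact ⟨fun δ hδ => hlow hδ.1, fun h => Or.inr h.1, fun h => ⟨h.resolve_left hk, hlow⟩⟩
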